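/- **Conventions.** A $d$-complex is a finite simplicial complex $X$ of dimension $d$ (a nonempty family of finite vertex sets closed under subsets, so $\emptyset\in X$) that is pure: all its maximal faces have dimension $d$, where $\dim\sigma=|\sigma|-1$. Let $X(k)$ be the set of $k$-dimensional faces, $C^k=C^k(X;\mathbb F_2)$ the space of functions $X(k)\to\mathbb F_2$ (identified with subsets of $X(k)$), $\delta:C^k\to C^{k+1}$, $(\delta f)(\tau)=\sum_{\sigma\subset\tau}f(\sigma)$, the coboundary map, and $B^k=\delta(C^{k-1})$ (with $C^{-2}=0$). For $A\in C^k$ put $$\|A\|=\sum_{\sigma\in A}w(\sigma),\qquad w(\sigma)=\frac{|\{F\in X(d):\sigma\subset F\}|}{\binom{d+1}{|\sigma|}\,|X(d)|}.$$ The link of $\sigma\in X$ is the $(d-|\sigma|)$-complex $X_\sigma=\{\tau\in X:\sigma\cap\tau=\emptyset,\ \sigma\cup\tau\in X\}$, with its own norm and coboundary map; the localization of $A\in C^k$ at $\sigma$ is the $(k-|\sigma|)$-cochain $I_\sigma(A)=\{\tau\in X_\sigma: \sigma\cap\tau=\emptyset,\ \sigma\cup\tau\in A\}$ of $X_\sigma$.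 A cochain $A\in C^k$ is minimal if $\|A\|=\min_{b\in B^k}\|A+b\|$, and locally minimal if $I_\sigma(A)$ is minimal in $X_\sigma$ for every $\emptyset\neq\sigma\in X$. A $d$-complex $X$ is an $\epsilon$-coboundary expander if for all $0\le k\le d-1$ and all $A\in C^k\setminus B^k$ one has $\|\delta A\|/\min_{b\in B^k}\|A+b\|\ge\epsilon$. It is an $\alpha$-skeleton expander if for every $A\subset X(0)$ one has $\|E(A,A)\|\le 4(\|A\|^2+\alpha\|A\|)$, where $E(A,A)\subset X(1)$ is the set of edges with both vertices in $A$. **Theorem.** For every $d\in\mathbb N$ and $\beta>0$ there exist $\bar\epsilon=\bar\epsilon(d,\beta)>0$, $\bar\mu=\bar\mu(d,\beta)>0$ and $\alpha=\alpha(d,\beta)>0$ such that the following holds for every $d$-complex $X$ (no bound on its degrees is assumed). Suppose that * the link $X_\sigma$ is a $\beta$-coboundary expander for every $\sigma\in X$ with $1\le|\sigma|\le d-1$, and * the link $X_\sigma$ is an $\alpha$-skeleton expander for every $\sigma\in X$ with $0\le|\sigma|\le d-1$ (in particular $X=X_\emptyset$ is one). Then for every $0\le k\le d-1$ and every locally minimal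 $A\in C^k$ with $\|A\|\le\bar\mu$, $$\|\delta A\|\ \ge\ \bar\epsilon\,\|A\|.$$ -/

import Mathlib

/-- A finite simplicial complex on the vertex set `V`: a nonempty finite family of finite subsets of
`V`, closed under taking subsets.  The empty set is always a face (of dimension `-1`). -/
structure FinComplex (V : Type*) where
  /-- the faces, including the empty one -/
  faces : Finset (Finset V)
  empty_mem : ∅ ∈ faces
  down_closed : ∀ F ∈ faces, ∀ E, E ⊆ F → E ∈ faces

namespace FinComplex

variable {V : Type*}

/-- The dimension of a complex: the maximum of `|F| - 1` over its faces `F`. -/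
def dim (X : FinComplex V) : ℤ := (X.faces.sup Finset.card : ℕ) - 1

/-- `X(k)`: the faces of dimension `k`, i.e. of cardinality `k + 1`. -/
def kFaces (X : FinComplex V) (k : ℤ) : Finset (Finset V) :=
  X.faces.filter fun σ => (σ.card : ℤ) = k + 1

/-- A `d`-complex: a (finite) complex of dimension `d` that is pure, i.e. all its maximal faces have
dimension `d`. -/
def IsDComplex (X : FinComplex V) (d : ℤ) : Prop :=
  X.dim = d ∧ ∀ F, Maximal (· ∈ X.faces) F → F ∈ X.kFaces d

/-- `C^k(X; 𝔽₂)`: functions from the `k`-faces to `𝔽₂`.  A set of `k`-faces is identified with its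
indicator function. -/
abbrev Cochain (X : FinComplex V) (k : ℤ) : Type _ := {σ // σ ∈ X.kFaces k} → ZMod 2

variable [DecidableEq V]

/-- The weight `w(σ) = |{F ∈ X(d) : σ ⊆ F}| / (binom (d+1) |σ| * |X(d)|)`, with `d = dim X`. -/
noncomputable def weight (X : FinComplex V) (σ : Finset V) : ℝ :=
  (((X.kFaces X.dim).filter fun F => σ ⊆ F).card : ℝ) /
    (((X.dim + 1).toNat.choose σ.card : ℝ) * ((X.kFaces X.dim).card : ℝ))

/-- The link `X_σ = {τ ∈ X : σ ⊔ τ ∈ X}` (disjoint union) of a face `σ`. -/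
def link (X : FinComplex V) (σ : Finset V) (hσ : σ ∈ X.faces) : FinComplex V where
  faces := X.faces.filter fun τ => Disjoint σ τ ∧ σ ∪ τ ∈ X.faces
  empty_mem := by simp [X.empty_mem, hσ]
  down_closed := by
    intro F hF E hE
    simp only [Finset.mem_filter] at hF ⊢
    exact ⟨X.down_closed F hF.1 E hE, hF.2.1.mono_right hE,
      X.down_closed _ hF.2.2 _ (Finset.union_subset_union_right hE)⟩

theorem union_mem_kFaces (X : FinComplex V) {σ : Finset V} (hσ : σ ∈ X.faces) {k : ℤ}
    {τ : Finset V} (hτ : τ ∈ (X.link σ hσ).kFaces (k - σ.card)) : σ ∪ τ ∈ X.kFaces k := by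
  simp only [kFaces, link, Finset.mem_filter] at hτ ⊢
  refine ⟨hτ.1.2.2, ?_⟩
  rw [Finset.card_union_of_disjoint hτ.1.2.1]
  have := hτ.2
  push_cast
  linarith

namespace Cochain

variable {X : FinComplex V} {k : ℤ}

/-- The norm `‖A‖ = ∑_{σ ∈ A} w(σ)`. -/
noncomputable def wnorm (A : X.Cochain k) : ℝ :=
  ∑ σ : {σ // σ ∈ X.kFaces k}, if A σ ≠ 0 then X.weight σ else 0

/-- The coboundary map `(δ f)(τ) = ∑_{σ ⊂ τ} f σ` from `C^k` to `C^l`, where `l = k + 1`.  (The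
degree `l` is kept as a separate variable so that `C^{k-1} → C^k` needs no cast.) -/
def delta (l : ℤ) (_h : l = k + 1) (A : X.Cochain k) : X.Cochain l :=
  fun τ => ∑ σ : {σ // σ ∈ X.kFaces k}, if σ.1 ⊆ τ.1 then A σ else 0

end Cochain

/-- `B^k`: the `k`-coboundaries, i.e. the image of `δ : C^{k-1} → C^k`. -/
def coboundaries (X : FinComplex V) (k : ℤ) : Set (X.Cochain k) :=
  Set.range (Cochain.delta (X := X) (k := k - 1) k (by ring))

namespace Cochain

variable {X : FinComplex V} {k : ℤ}

/-- `min_{b ∈ B^k} ‖A + b‖` (an infimum over a finite nonempty set). -/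
noncomputable def minNorm (A : X.Cochain k) : ℝ :=
  ⨅ b : X.coboundaries k, wnorm (A + b.1)

/-- A cochain is minimal if `‖A‖ = min_{b ∈ B^k} ‖A + b‖`. -/
def IsMinimal (A : X.Cochain k) : Prop := A.wnorm = A.minNorm

/-- The localization `I_σ(A) = {τ ∈ X_σ : σ ⊔ τ ∈ A}`, a `(k - |σ|)`-cochain of the link. -/
def localize (A : X.Cochain k) (σ : Finset V) (hσ : σ ∈ X.faces) :
    (X.link σ hσ).Cochain (k - σ.card) :=
  fun τ => A ⟨σ ∪ τ.1, X.union_mem_kFaces hσ τ.2⟩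

/-- A cochain is locally minimal if its localization at every nonempty face is minimal in the
link of that face. -/
def IsLocallyMinimal (A : X.Cochain k) : Prop :=
  ∀ (σ : Finset V) (hσ : σ ∈ X.faces), σ ≠ ∅ → (A.localize σ hσ).IsMinimal

/-- `E(A,A)`: the edges of `X` with both vertices in the vertex set `A`. -/
def innerEdges (A : X.Cochain 0) : X.Cochain 1 :=
  fun e => if ∀ v : {σ // σ ∈ X.kFaces 0}, v.1 ⊆ e.1 → A v ≠ 0 then 1 else 0

end Cochain

/-- The coboundary expansion parameter
`Exp_b^k(X) = min { ‖δ A‖ / min_{b ∈ B^k} ‖A + b‖ : A ∈ C^k \ B^k }` (`⊤` if `C^k = B^k`). -/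
noncomputable def expB (X : FinComplex V) (k : ℤ) : EReal :=
  ⨅ A : {A : X.Cochain k // A ∉ X.coboundaries k},
    (((A.1.delta (k + 1) rfl).wnorm / A.1.minNorm : ℝ) : EReal)

/-- `X` is an `ε`-coboundary expander: `Exp_b^k(X) ≥ ε` for all `0 ≤ k ≤ dim X - 1`. -/
def IsCoboundaryExpander (X : FinComplex V) (ε : ℝ) : Prop :=
  ∀ k : ℤ, 0 ≤ k → k ≤ X.dim - 1 → (ε : EReal) ≤ X.expB k

/-- `X` is an `α`-skeleton expander: `‖E(A,A)‖ ≤ 4 (‖A‖² + α ‖A‖)` for every set `A` of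
vertices. -/
def IsSkeletonExpander (X : FinComplex V) (α : ℝ) : Prop :=
  ∀ A : X.Cochain 0, A.innerEdges.wnorm ≤ 4 * (A.wnorm ^ 2 + α * A.wnorm)

end FinComplex

/-! Identify the cochain `A` with a set of faces of cardinality `n = k + 1`. Expansion is available
only in links of nonempty faces, so `A` is covered by pieces `S m`, each consisting of faces above
one nonempty face `m`. A subset of a minimal cochain is minimal, so the link of `m` bounds the
coboundary of `S m` from below (`sum_odd_ge`). What remains is to compare these coboundaries with
that of `A`.

The faces `m` come from fatness. Starting from `A`, a face is fat of codegree `c + 1` if fat faces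
of codegree `c` occupy at least the proportion `η ^ 2 ^ c` of the vertices of its link. Each member
of `A` descends through fat faces to terminal ones. Smallness of `‖A‖` prevents `∅` from being fat,
so terminal faces are nonempty.

Call a face of cardinality `n + 1` degenerate if it contains two adjacent fat faces with a nonfat
intersection. Inside a nondegenerate face the descent has the diamond property, so by Church–Rosser
all members of `A` in it reach the same terminal face: at most one piece has a nonzero coboundary
there, and then so does `A`. A degenerate face lies above an edge spanned by a thin vertex set in
the link of a nonfat face, so skeleton expansion bounds the total weight of such faces by `O(η) ‖A‖`
(`sum_degenerate_le`). For small `η` this error is absorbed. -/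

namespace FinComplex

open Finset

/-! ### Weights of faces and links in pure complexes. -/

variable {V : Type*}

/-- The faces of cardinality `j`. -/
def level (X : FinComplex V) (j : ℕ) : Finset (Finset V) := X.faces.filter fun σ => σ.card = j

theorem mem_level {X : FinComplex V} {j : ℕ} {σ : Finset V} :
    σ ∈ X.level j ↔ σ ∈ X.faces ∧ σ.card = j := by
  simp [level]

theorem kFaces_eq_level (X : FinComplex V) {k : ℤ} {j : ℕ} (h : (j : ℤ) = k + 1) :
    X.kFaces k = X.level j := by
  ext σ
  simp only [kFaces, level, mem_filter, ← h, Nat.cast_inj]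

namespace IsDComplex

variable {X : FinComplex V} {d : ℕ}

theorem exists_facet (hX : X.IsDComplex d) {σ : Finset V} (hσ : σ ∈ X.faces) :
    ∃ F ∈ X.level (d + 1), σ ⊆ F := by
  obtain ⟨F, hle, hF⟩ := X.faces.exists_le_maximal hσ
  refine ⟨F, ?_, hle⟩
  rw [← X.kFaces_eq_level (k := d) (by push_cast; ring)]
  exact hX.2 F hF

theorem card_le (hX : X.IsDComplex d) {σ : Finset V} (hσ : σ ∈ X.faces) : σ.card ≤ d + 1 := by
  obtain ⟨F, hF, h⟩ := hX.exists_facet hσ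
  exact (card_le_card h).trans (mem_level.1 hF).2.le

theorem kFaces_dim (hX : X.IsDComplex d) : X.kFaces X.dim = X.level (d + 1) := by
  rw [hX.1, X.kFaces_eq_level (k := d) (j := d + 1) (by push_cast; ring)]

end IsDComplex

variable [DecidableEq V]

/-- The number of facets of a pure complex of dimension `d` that contain `σ`. -/
def numFacets (X : FinComplex V) (d : ℕ) (σ : Finset V) : ℕ :=
  ((X.level (d + 1)).filter fun F => σ ⊆ F).card

theorem weight_nonneg (X : FinComplex V) (σ : Finset V) : 0 ≤ X.weight σ := by
  unfold weight; positivity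

theorem card_between {F σ : Finset V} (h : σ ⊆ F) {j : ℕ} (hj : σ.card ≤ j) :
    ((powersetCard j F).filter fun τ => σ ⊆ τ).card = (F.card - σ.card).choose (j - σ.card) := by
  rw [← card_sdiff_of_subset h, ← card_powersetCard]
  refine card_nbij' (· \ σ) (σ ∪ ·) ?_ ?_ ?_ ?_
  · intro τ hτ
    simp only [mem_coe, mem_filter, mem_powersetCard] at hτ ⊢
    exact ⟨sdiff_subset_sdiff hτ.1.1 subset_rfl, by rw [card_sdiff_of_subset hτ.2, hτ.1.2]⟩
  · intro τ hτ
    simp only [mem_coe, mem_filter, mem_powersetCard] at hτ ⊢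
    have hd : Disjoint σ τ := (disjoint_sdiff (s := σ) (t := F)).mono_right hτ.1
    refine ⟨⟨union_subset h (hτ.1.trans sdiff_subset), ?_⟩, subset_union_left⟩
    rw [card_union_of_disjoint hd, hτ.2]; omega
  · intro τ hτ
    simp only [mem_coe, mem_filter, mem_powersetCard] at hτ
    exact union_sdiff_of_subset hτ.2
  · intro τ hτ
    simp only [mem_coe, mem_powersetCard] at hτ
    have hd : Disjoint σ τ := (disjoint_sdiff (s := σ) (t := F)).mono_right hτ.1
    exact union_sdiff_cancel_left hd

namespace IsDComplex

variable {X : FinComplex V} {d : ℕ}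

theorem numFacets_pos (hX : X.IsDComplex d) {σ : Finset V} (hσ : σ ∈ X.faces) :
    0 < X.numFacets d σ := by
  obtain ⟨F, hF, h⟩ := hX.exists_facet hσ
  exact card_pos.2 ⟨F, mem_filter.2 ⟨hF, h⟩⟩

theorem weight_eq (hX : X.IsDComplex d) (σ : Finset V) :
    X.weight σ = X.numFacets d σ / (((d + 1).choose σ.card : ℝ) * X.numFacets d ∅) := by
  have hd : (X.dim + 1).toNat = d + 1 := by rw [hX.1]; omega
  rw [weight, hX.kFaces_dim, hd, numFacets, numFacets]
  simp

theorem weight_empty (hX : X.IsDComplex d) : X.weight ∅ = 1 := by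
  have : (0 : ℝ) < X.numFacets d ∅ := by exact_mod_cast hX.numFacets_pos X.empty_mem
  rw [hX.weight_eq]; simp [this.ne']

theorem sum_numFacets (σ : Finset V) {j : ℕ} (hj : σ.card ≤ j) :
    ∑ τ ∈ (X.level j).filter (fun τ => σ ⊆ τ), X.numFacets d τ =
      (d + 1 - σ.card).choose (j - σ.card) * X.numFacets d σ := by
  have h1 : ∀ F ∈ X.level (d + 1), σ ⊆ F →
      (((X.level j).filter (fun τ => σ ⊆ τ)).filter fun τ => τ ⊆ F).card =
        (d + 1 - σ.card).choose (j - σ.card) := by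
    intro F hF h
    rw [← (mem_level.1 hF).2, ← card_between h hj]
    congr 1
    ext τ
    simp only [mem_filter, mem_level, mem_powersetCard]
    constructor
    · rintro ⟨⟨⟨-, a⟩, b⟩, c⟩; exact ⟨⟨c, a⟩, b⟩
    · rintro ⟨⟨c, a⟩, b⟩; exact ⟨⟨⟨X.down_closed _ (mem_level.1 hF).1 _ c, a⟩, b⟩, c⟩
  simp only [numFacets, card_filter]
  rw [sum_comm, mul_sum]
  refine sum_congr rfl fun F hF => ?_
  rw [← card_filter]
  by_cases h : σ ⊆ F
  · rw [h1 F hF h]; simp [h]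
  · simp only [h, if_false, mul_zero, card_eq_zero, filter_eq_empty_iff, mem_filter]
    exact fun τ hτ h' => h (hτ.2.trans h')

/-- The weight is the law of a uniformly random subset of given size of a uniformly random facet, so
this is double counting; each facet above `σ` contains the same number of intermediate faces. -/
theorem sum_weight (hX : X.IsDComplex d) {σ : Finset V} {j : ℕ} (hj : σ.card ≤ j)
    (hd : j ≤ d + 1) :
    ∑ τ ∈ (X.level j).filter (fun τ => σ ⊆ τ), X.weight τ =
      (j.choose σ.card : ℝ) * X.weight σ := by
  have h1 : ∀ τ ∈ (X.level j).filter (fun τ => σ ⊆ τ), X.weight τ =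
      (X.numFacets d τ : ℝ) / (((d + 1).choose j : ℝ) * X.numFacets d ∅) := by
    intro τ hτ
    rw [hX.weight_eq, (mem_level.1 (mem_filter.1 hτ).1).2]
  have hM : (0 : ℝ) < X.numFacets d ∅ := by exact_mod_cast hX.numFacets_pos X.empty_mem
  have hc : (0 : ℝ) < (d + 1).choose j := by exact_mod_cast Nat.choose_pos hd
  have hc' : (0 : ℝ) < (d + 1).choose σ.card := by exact_mod_cast Nat.choose_pos (hj.trans hd)
  have hm : ((d + 1).choose j : ℝ) * j.choose σ.card =
      (d + 1).choose σ.card * (d + 1 - σ.card).choose (j - σ.card) := by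
    exact_mod_cast Nat.choose_mul (n := d + 1) (k := j) (s := σ.card) hj
  rw [sum_congr rfl h1, ← sum_div, ← Nat.cast_sum, sum_numFacets σ hj, hX.weight_eq]
  push_cast
  rw [← mul_div_assoc, div_eq_div_iff (by positivity) (by positivity)]
  linear_combination (-(X.numFacets d σ : ℝ) * X.numFacets d ∅) * hm

end IsDComplex

theorem mem_link {X : FinComplex V} {σ τ : Finset V} {hσ : σ ∈ X.faces} :
    τ ∈ (X.link σ hσ).faces ↔ Disjoint σ τ ∧ σ ∪ τ ∈ X.faces := by
  simp only [link, mem_filter, and_iff_right_iff_imp]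
  exact fun h => X.down_closed _ h.2 _ subset_union_right

theorem sum_link {M : Type*} [AddCommMonoid M] (X : FinComplex V) {σ : Finset V}
    (hσ : σ ∈ X.faces) {j l : ℕ} (hl : l = σ.card + j) (f : Finset V → M) :
    ∑ τ ∈ (X.link σ hσ).level j, f (σ ∪ τ) =
      ∑ τ ∈ (X.level l).filter (fun τ => σ ⊆ τ), f τ := by
  refine sum_nbij' (σ ∪ ·) (· \ σ) ?_ ?_ ?_ ?_ ?_
  · intro τ hτ
    simp only [mem_level, mem_link, mem_filter] at hτ ⊢
    rw [card_union_of_disjoint hτ.1.1]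
    exact ⟨⟨hτ.1.2, by omega⟩, subset_union_left⟩
  · intro τ hτ
    simp only [mem_level, mem_link, mem_filter] at hτ ⊢
    rw [union_sdiff_of_subset hτ.2, card_sdiff_of_subset hτ.2]
    exact ⟨⟨disjoint_sdiff, hτ.1.1⟩, by omega⟩
  · intro τ hτ
    simp only [mem_level, mem_link] at hτ
    exact union_sdiff_cancel_left hτ.1.1
  · intro τ hτ
    exact union_sdiff_of_subset (mem_filter.1 hτ).2
  · intros; rfl

namespace IsDComplex

variable {X : FinComplex V} {d : ℕ}

theorem link (hX : X.IsDComplex d) {σ : Finset V} (hσ : σ ∈ X.faces) :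
    (X.link σ hσ).IsDComplex ((d : ℤ) - σ.card) := by
  have hle : ∀ τ ∈ (X.link σ hσ).faces,
      ∃ F ∈ (X.link σ hσ).faces, τ ⊆ F ∧ F.card + σ.card = d + 1 := by
    intro τ hτ
    rw [mem_link] at hτ
    obtain ⟨F, hF, h⟩ := hX.exists_facet hτ.2
    rw [mem_level] at hF
    have hσF : σ ⊆ F := subset_union_left.trans h
    refine ⟨F \ σ, ?_, ?_, ?_⟩
    · rw [mem_link, union_sdiff_of_subset hσF]; exact ⟨disjoint_sdiff, hF.1⟩
    · exact subset_sdiff.2 ⟨subset_union_right.trans h, hτ.1.symm⟩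
    · rw [card_sdiff_add_card_eq_card hσF, hF.2]
  have hmax : (X.link σ hσ).faces.sup card + σ.card = d + 1 := by
    obtain ⟨F, hF, -, hc⟩ := hle ∅ (X.link σ hσ).empty_mem
    apply le_antisymm
    · suffices (X.link σ hσ).faces.sup card ≤ d + 1 - σ.card by
        have := hX.card_le hσ; omega
      refine Finset.sup_le fun τ hτ => ?_
      obtain ⟨F, -, h, hc⟩ := hle τ hτ
      have := card_le_card h
      omega
    · rw [← hc]; gcongr; exact Finset.le_sup (f := card) hF
  refine ⟨by rw [dim]; omega, fun F hF => ?_⟩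
  obtain ⟨G, hG, h, hc⟩ := hle F hF.1
  have : F = G := hF.eq_of_le hG h
  subst this
  simp only [kFaces, mem_filter]
  exact ⟨hF.1, by omega⟩

theorem weight_link (hX : X.IsDComplex d) {σ : Finset V} (hσ : σ ∈ X.faces) {τ : Finset V}
    (hτ : τ ∈ (X.link σ hσ).faces) :
    (X.link σ hσ).weight τ * (((σ.card + τ.card).choose σ.card : ℝ) * X.weight σ) =
      X.weight (σ ∪ τ) := by
  have hτ' := mem_link.1 hτ
  have hcard : (σ ∪ τ).card = σ.card + τ.card := card_union_of_disjoint hτ'.1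
  have hle : σ.card + τ.card ≤ d + 1 := hcard ▸ hX.card_le hτ'.2
  have hdim : (X.link σ hσ).dim = (d : ℤ) - σ.card := (hX.link hσ).1
  have hnat : ((X.link σ hσ).dim + 1).toNat = d + 1 - σ.card := by omega
  have hlev : (X.link σ hσ).kFaces (X.link σ hσ).dim = (X.link σ hσ).level (d + 1 - σ.card) :=
    kFaces_eq_level _ (by omega)
  have hN : ∀ ρ ∈ (X.link σ hσ).faces,
      (((X.link σ hσ).level (d + 1 - σ.card)).filter fun F => ρ ⊆ F).card =
        X.numFacets d (σ ∪ ρ) := by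
    intro ρ hρ
    have h1 := X.sum_link hσ (j := d + 1 - σ.card) (l := d + 1) (by omega)
      (fun F => if σ ∪ ρ ⊆ F then 1 else 0)
    rw [numFacets, card_filter, card_filter]
    trans ∑ F ∈ (X.link σ hσ).level (d + 1 - σ.card), if σ ∪ ρ ⊆ σ ∪ F then 1 else 0
    · refine sum_congr rfl fun F hF => ?_
      have : ρ ⊆ F ↔ σ ∪ ρ ⊆ σ ∪ F := by
        refine ⟨fun h => union_subset_union_right h, fun h v hv => ?_⟩
        exact (mem_union.1 (h (mem_union_right _ hv))).resolve_left
          fun hvσ => disjoint_left.1 (mem_link.1 hρ).1 hvσ hv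
      simp only [this]
    · rw [h1, sum_filter]
      refine sum_congr rfl fun F _ => ?_
      by_cases h : σ ∪ ρ ⊆ F
      · simp [h, subset_union_left.trans h]
      · simp [h]
  have hN0 : ((X.link σ hσ).level (d + 1 - σ.card)).card = X.numFacets d σ := by
    have := hN ∅ (X.link σ hσ).empty_mem
    simpa using this
  have hM : (0 : ℝ) < X.numFacets d ∅ := by exact_mod_cast hX.numFacets_pos X.empty_mem
  have hNσ : (0 : ℝ) < X.numFacets d σ := by exact_mod_cast hX.numFacets_pos hσ
  have hc1 : (0 : ℝ) < (d + 1).choose σ.card := by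
    exact_mod_cast Nat.choose_pos (by omega)
  have hc2 : (0 : ℝ) < (d + 1).choose (σ.card + τ.card) := by exact_mod_cast Nat.choose_pos hle
  have hc3 : (0 : ℝ) < (d + 1 - σ.card).choose τ.card := by
    exact_mod_cast Nat.choose_pos (by omega)
  have hm : ((d + 1).choose (σ.card + τ.card) : ℝ) * (σ.card + τ.card).choose σ.card =
      (d + 1).choose σ.card * (d + 1 - σ.card).choose τ.card := by
    have := Nat.choose_mul (n := d + 1) (k := σ.card + τ.card) (s := σ.card) (by omega)
    rw [Nat.add_sub_cancel_left] at this
    exact_mod_cast this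
  rw [hX.weight_eq, hX.weight_eq, weight, hnat, hlev, hN τ hτ, hN0, hcard]
  rw [← mul_div_assoc, div_mul_div_comm, div_eq_div_iff (by positivity) (by positivity)]
  linear_combination ((X.numFacets d σ : ℝ) * X.numFacets d (σ ∪ τ) * X.numFacets d ∅) * hm

end IsDComplex
end FinComplex
-- Minimal cochains, and expansion of links read in the ambient complex.
namespace FinComplex

open Finset

variable {V : Type*} [DecidableEq V]

namespace Cochain

variable {X : FinComplex V} {k : ℤ}

theorem wnorm_eq_sum (A : X.Cochain k) {j : ℕ} (hj : (j : ℤ) = k + 1) (P : Finset V → Prop)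
    [DecidablePred P] (hP : ∀ σ, A σ ≠ 0 ↔ P σ.1) :
    A.wnorm = ∑ σ ∈ X.level j, if P σ then X.weight σ else 0 := by
  rw [wnorm, ← X.kFaces_eq_level hj,
    ← sum_coe_sort (X.kFaces k) fun σ => if P σ then X.weight σ else 0]
  exact sum_congr rfl fun σ _ => by simp only [hP]

theorem wnorm_nonneg (A : X.Cochain k) : 0 ≤ A.wnorm :=
  sum_nonneg fun σ _ => by split_ifs <;> simp [X.weight_nonneg]

theorem wnorm_zero : (0 : X.Cochain k).wnorm = 0 := by simp [wnorm]

theorem zero_mem_coboundaries : (0 : X.Cochain k) ∈ X.coboundaries k :=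
  ⟨0, by ext; simp [delta]⟩

theorem bddBelow_wnorm (A : X.Cochain k) :
    BddBelow (Set.range fun b : X.coboundaries k => wnorm (A + b.1)) :=
  ⟨0, by rintro _ ⟨b, rfl⟩; exact wnorm_nonneg _⟩

theorem minNorm_nonneg (A : X.Cochain k) : 0 ≤ A.minNorm :=
  Real.iInf_nonneg fun _ => wnorm_nonneg _

theorem minNorm_le (A : X.Cochain k) {b : X.Cochain k} (hb : b ∈ X.coboundaries k) :
    A.minNorm ≤ (A + b).wnorm :=
  ciInf_le (bddBelow_wnorm A) ⟨b, hb⟩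

theorem isMinimal_iff {A : X.Cochain k} :
    A.IsMinimal ↔ ∀ b ∈ X.coboundaries k, A.wnorm ≤ (A + b).wnorm := by
  constructor
  · intro h b hb
    rw [IsMinimal] at h
    exact h ▸ A.minNorm_le hb
  · intro h
    have : Nonempty (X.coboundaries k) := ⟨⟨0, zero_mem_coboundaries⟩⟩
    refine le_antisymm (le_ciInf fun b => h b.1 b.2) ?_
    simpa using A.minNorm_le zero_mem_coboundaries

/-- A subset of a minimal cochain is minimal. -/
theorem IsMinimal.mono {A B : X.Cochain k} (hA : A.IsMinimal) (h : ∀ σ, B σ ≠ 0 → A σ ≠ 0) :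
    B.IsMinimal := by
  rw [isMinimal_iff] at hA ⊢
  intro b hb
  have hpt : ∀ (x y z : ZMod 2) (w : ℝ), 0 ≤ w → (y ≠ 0 → x ≠ 0) →
      (if y ≠ 0 then w else 0) + (if x + z ≠ 0 then w else 0) ≤
        (if y + z ≠ 0 then w else 0) + if x ≠ 0 then w else 0 := by
    intro x y z w hw hyx
    have h2 : (1 + 1 : ZMod 2) = 0 := by decide
    have h01 : ∀ u : ZMod 2, u = 0 ∨ u = 1 := by decide
    rcases h01 x with rfl | rfl <;> rcases h01 y with rfl | rfl <;>
      rcases h01 z with rfl | rfl <;> simp_all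
  -- Adding `b` changes `‖B‖` by at least as much as it changes `‖A‖`: the two changes agree on `B`
  -- and off `A`, and on `A \ B` the set `B` can only gain while `A` can only lose.
  have key : B.wnorm + (A + b).wnorm ≤ (B + b).wnorm + A.wnorm := by
    simp only [wnorm, ← sum_add_distrib]
    refine sum_le_sum fun σ _ => ?_
    exact hpt _ _ _ _ (X.weight_nonneg _) (h σ)
  linarith [hA b hb]

theorem IsMinimal.le_wnorm_delta {β : ℝ} (hX : X.IsCoboundaryExpander β)
    (h0 : 0 ≤ k) (hk : k ≤ X.dim - 1) {A : X.Cochain k} (hA : A.IsMinimal) :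
    β * A.wnorm ≤ (A.delta (k + 1) rfl).wnorm := by
  by_cases hB : A ∈ X.coboundaries k
  · have h1 := isMinimal_iff.1 hA A hB
    have h2 : A + A = 0 := by ext σ; exact CharTwo.add_self_eq_zero _
    rw [h2, wnorm_zero] at h1
    rw [le_antisymm h1 A.wnorm_nonneg, mul_zero]
    exact wnorm_nonneg _
  · have h1 := (hX k h0 hk).trans (iInf_le _ (⟨A, hB⟩ : {A : X.Cochain k // A ∉ X.coboundaries k}))
    rw [EReal.coe_le_coe_iff] at h1
    rw [hA]
    -- If the minimum is `0`, the quotient is `0` by convention and says nothing, but then `‖A‖ = 0`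
    -- as well.
    rcases (minNorm_nonneg A).eq_or_lt with h2 | h2
    · rw [← h2, mul_zero]; exact wnorm_nonneg _
    · exact (le_div_iff₀ h2).1 h1

theorem delta_ne_zero_iff (A : X.Cochain k) {l : ℤ} (hl : l = k + 1) {S : Finset (Finset V)}
    (hS : S ⊆ X.kFaces k) (hA : ∀ σ, A σ ≠ 0 ↔ σ.1 ∈ S) (τ : {τ // τ ∈ X.kFaces l}) :
    A.delta l hl τ ≠ 0 ↔ Odd (S.filter fun a => a ⊆ τ.1).card := by
  have h1 : A.delta l hl τ = ((S.filter fun a => a ⊆ τ.1).card : ZMod 2) := by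
    have h2 : S.filter (fun a => a ⊆ τ.1) =
        (X.kFaces k).filter fun a => a ⊆ τ.1 ∧ a ∈ S := by
      ext a; simp only [mem_filter]
      exact ⟨fun h => ⟨hS h.1, h.2, h.1⟩, fun h => ⟨h.2.2, h.2.1⟩⟩
    rw [h2, card_filter, delta, Nat.cast_sum,
      ← sum_coe_sort (X.kFaces k) fun a => (((if a ⊆ τ.1 ∧ a ∈ S then 1 else 0 : ℕ)) : ZMod 2)]
    refine sum_congr rfl fun σ _ => ?_
    have h3 := hA σ
    by_cases hσ : σ.1 ⊆ τ.1 <;> by_cases hσS : σ.1 ∈ S <;> simp only [hσ, hσS] at h3 ⊢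
    · have h01 : ∀ u : ZMod 2, u ≠ 0 → u = 1 := by decide
      simpa using h01 _ (h3.2 trivial)
    · simpa using h3
    · simp
    · simp
  rw [h1]
  exact ZMod.natCast_ne_zero_iff_odd

end Cochain

namespace IsDComplex

variable {X : FinComplex V} {d : ℕ}

theorem weight_pos (hX : X.IsDComplex d) {σ : Finset V} (hσ : σ ∈ X.faces) : 0 < X.weight σ := by
  have h1 : (0 : ℝ) < X.numFacets d ∅ := by exact_mod_cast hX.numFacets_pos X.empty_mem
  have h2 : (0 : ℝ) < X.numFacets d σ := by exact_mod_cast hX.numFacets_pos hσ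
  have h3 : (0 : ℝ) < (d + 1).choose σ.card := by
    exact_mod_cast Nat.choose_pos (hX.card_le hσ)
  rw [hX.weight_eq]
  positivity

/-- Transfers every norm in a link to a sum of ambient weights above `σ`; the binomial factor is the
one by which the two normalizations differ. -/
theorem wnorm_link (hX : X.IsDComplex d) {σ : Finset V} (hσ : σ ∈ X.faces) {k : ℤ}
    (A : (X.link σ hσ).Cochain k) {l : ℕ} (hk : -1 ≤ k) (hl : (l : ℤ) = σ.card + k + 1)
    (P : Finset V → Prop) [DecidablePred P] (hP : ∀ τ, A τ ≠ 0 ↔ P (σ ∪ τ.1)) :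
    A.wnorm * ((l.choose σ.card : ℝ) * X.weight σ) =
      ∑ τ ∈ (X.level l).filter (fun τ => σ ⊆ τ), if P τ then X.weight τ else 0 := by
  obtain ⟨j, hj⟩ : ∃ j : ℕ, (j : ℤ) = k + 1 := ⟨(k + 1).toNat, by omega⟩
  obtain rfl : l = σ.card + j := by omega
  rw [A.wnorm_eq_sum hj (fun τ => P (σ ∪ τ)) hP, ← X.sum_link hσ rfl, sum_mul]
  refine sum_congr rfl fun τ hτ => ?_
  rw [ite_mul, zero_mul]
  rw [mem_level] at hτ
  rw [← hX.weight_link hσ hτ.1, hτ.2]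

/-- Vertices of the link of `ρ` correspond to faces of cardinality `ρ.card + 1` above `ρ`, so an
inner edge is a face all of whose intermediate faces over `ρ` belong to `B`. -/
theorem innerEdges_link_ne_zero_iff {ρ : Finset V} (hρ : ρ ∈ X.faces) {B : Finset (Finset V)}
    {C : (X.link ρ hρ).Cochain 0} (hC : ∀ v, C v ≠ 0 ↔ ρ ∪ v.1 ∈ B)
    (e : {e // e ∈ (X.link ρ hρ).kFaces 1}) :
    C.innerEdges e ≠ 0 ↔ ∀ σ ∈ X.level (ρ.card + 1), ρ ⊆ σ → σ ⊆ ρ ∪ e.1 → σ ∈ B := by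
  simp only [Cochain.innerEdges, hC, ne_eq, ite_eq_right_iff, one_ne_zero, imp_false, not_not]
  constructor
  · intro H σ hσ hρσ hσe
    have h3 := H ⟨σ \ ρ, ?_⟩ ?_
    · simpa only [union_sdiff_of_subset hρσ] using h3
    · rw [kFaces_eq_level _ (j := 1) (by norm_num), mem_level, mem_link,
        union_sdiff_of_subset hρσ, card_sdiff_of_subset hρσ]
      rw [mem_level] at hσ
      exact ⟨⟨disjoint_sdiff, hσ.1⟩, by omega⟩
    · exact sdiff_le_iff.2 hσe
  · intro H v hv
    have hv2 : v.1 ∈ (X.link ρ hρ).level 1 := by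
      rw [← kFaces_eq_level _ (k := 0) (by norm_num)]; exact v.2
    rw [mem_level, mem_link] at hv2
    refine H _ ?_ subset_union_left (union_subset_union_right hv)
    rw [mem_level, card_union_of_disjoint hv2.1.1, hv2.2]
    exact ⟨hv2.1.2, rfl⟩

open Classical in
/-- The skeleton expansion of the link of `ρ`, in terms of the faces of `X` above `ρ`. -/
theorem sum_edges_le (hX : X.IsDComplex d) {ρ : Finset V} (hρ : ρ ∈ X.faces) {α : ℝ}
    (hS : (X.link ρ hρ).IsSkeletonExpander α) {B : Finset (Finset V)}
    (hB : B ⊆ X.level (ρ.card + 1)) {h : ℝ}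
    (hh : ∑ σ ∈ B.filter (fun σ => ρ ⊆ σ), X.weight σ ≤ h * ((ρ.card + 1) * X.weight ρ)) :
    ∑ e ∈ ((X.level (ρ.card + 2)).filter fun e => ρ ⊆ e).filter (fun e =>
        ∀ σ ∈ X.level (ρ.card + 1), ρ ⊆ σ → σ ⊆ e → σ ∈ B), X.weight e ≤
      2 * (ρ.card + 2) * (h + α) * ∑ σ ∈ B.filter (fun σ => ρ ⊆ σ), X.weight σ := by
  obtain ⟨C, hC⟩ : ∃ C : (X.link ρ hρ).Cochain 0, ∀ v, C v ≠ 0 ↔ ρ ∪ v.1 ∈ B :=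
    ⟨fun v => if ρ ∪ v.1 ∈ B then 1 else 0, fun v => by simp⟩
  have h1 := hX.wnorm_link hρ C (l := ρ.card + 1) (by norm_num) (by push_cast; ring) (· ∈ B) hC
  have h2 := hX.wnorm_link hρ C.innerEdges (l := ρ.card + 2) (by norm_num) (by push_cast; ring)
    (fun e => ∀ σ ∈ X.level (ρ.card + 1), ρ ⊆ σ → σ ⊆ e → σ ∈ B)
    (innerEdges_link_ne_zero_iff hρ hC)
  have hs : ∑ τ ∈ (X.level (ρ.card + 1)).filter (fun τ => ρ ⊆ τ),
      (if τ ∈ B then X.weight τ else 0) = ∑ σ ∈ B.filter (fun σ => ρ ⊆ σ), X.weight σ := by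
    rw [← sum_filter, filter_filter]
    refine sum_congr ?_ fun _ _ => rfl
    ext τ; simp only [mem_filter]
    exact ⟨fun h => ⟨h.2.2, h.2.1⟩, fun h => ⟨hB h.1, h.2, h.1⟩⟩
  have hsk := hS C
  have hn := C.wnorm_nonneg
  have hw := hX.weight_pos hρ
  rw [hs] at h1
  rw [sum_filter (p := fun e => ∀ σ ∈ X.level (ρ.card + 1), ρ ⊆ σ → σ ⊆ e → σ ∈ B), ← h2]
  clear h2 hs hC
  generalize C.innerEdges.wnorm = x at *
  generalize C.wnorm = b at *
  generalize ∑ σ ∈ B.filter (fun σ => ρ ⊆ σ), X.weight σ = s at *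
  generalize X.weight ρ = w at *
  have hc1 : ((ρ.card + 1).choose ρ.card : ℝ) = ρ.card + 1 := by
    exact_mod_cast Nat.choose_succ_self_right ρ.card
  have hc2 : ((ρ.card + 2).choose ρ.card : ℝ) * 2 = (ρ.card + 2) * (ρ.card + 1) := by
    rw [Nat.choose_symm_add, Nat.cast_choose_two]; push_cast; ring
  rw [hc1] at h1
  have hbh : b ≤ h := by
    rw [← h1] at hh
    exact le_of_mul_le_mul_right hh (by positivity)
  have hs0 : 0 ≤ s := by rw [← h1]; positivity
  calc x * (((ρ.card + 2).choose ρ.card : ℝ) * w)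
      ≤ (4 * (b ^ 2 + α * b)) * (((ρ.card + 2).choose ρ.card : ℝ) * w) :=
        mul_le_mul_of_nonneg_right hsk (by positivity)
    _ = 2 * (ρ.card + 2) * (b + α) * s := by
        rw [← h1]; linear_combination 2 * (b ^ 2 + α * b) * w * hc2
    _ ≤ 2 * (ρ.card + 2) * (h + α) * s := by
        gcongr

/-- The coboundary expansion of the link of `m`, applied to a subset of the localization of a
cochain which is minimal there. -/
theorem sum_odd_ge (hX : X.IsDComplex d) {β : ℝ} (hβ1 : β ≤ 1) {n : ℕ} (hn : n ≤ d)
    {k : ℤ} (hk : (n : ℤ) = k + 1) {m : Finset V} (hm : m ∈ X.faces) (hmn : m.card ≤ n)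
    (hE : m.card < n → (X.link m hm).IsCoboundaryExpander β) {A : X.Cochain k}
    (hA : (A.localize m hm).IsMinimal) {S : Finset (Finset V)}
    (hS : ∀ a ∈ S, ∃ h, A ⟨a, h⟩ ≠ 0) (hmS : ∀ a ∈ S, m ⊆ a) :
    β * ∑ a ∈ S, X.weight a ≤
      ∑ τ ∈ (X.level (n + 1)).filter (fun τ => Odd (S.filter fun a => a ⊆ τ).card),
        X.weight τ := by
  classical
  have hSn : S ⊆ X.level n := by
    intro a ha
    obtain ⟨h, -⟩ := hS a ha
    rwa [kFaces_eq_level _ hk] at h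
  rcases S.eq_empty_or_nonempty with rfl | hne
  · simp
  -- When `m` has cardinality `n`, necessarily `S = {m}` and no expansion is needed: all faces of
  -- cardinality `n + 1` above `m` are counted, with total weight `(n + 1) w(m)`, and `β ≤ 1`
  -- suffices.
  rcases hmn.eq_or_lt with hc | hc
  · have hSm : S = {m} := by
      refine eq_singleton_iff_nonempty_unique_mem.2 ⟨hne, fun a ha => ?_⟩
      exact (eq_of_subset_of_card_le (hmS a ha) (by rw [(mem_level.1 (hSn ha)).2, hc])).symm
    have h1 : ∀ τ, Odd (({m} : Finset (Finset V)).filter fun a => a ⊆ τ).card ↔ m ⊆ τ := by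
      intro τ
      by_cases h : m ⊆ τ <;> simp [filter_singleton, h]
    rw [hSm]
    simp only [h1, sum_singleton]
    rw [hX.sum_weight (by omega) (by omega), hc, Nat.choose_succ_self_right]
    have hw := X.weight_nonneg m
    push_cast
    nlinarith
  set C : (X.link m hm).Cochain (k - m.card) := fun v => if m ∪ v.1 ∈ S then 1 else 0 with hC
  have hCv : ∀ v, C v ≠ 0 ↔ m ∪ v.1 ∈ S := fun v => by simp [hC]
  have hCmin : C.IsMinimal := hA.mono fun v hv => (hS _ ((hCv v).1 hv)).2
  have hexp := hCmin.le_wnorm_delta (hE hc) (by omega) (by rw [(hX.link hm).1]; omega)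
  have h1 := hX.wnorm_link hm C (l := n) (by omega) (by omega) (· ∈ S) hCv
  have hodd : ∀ t, C.delta _ rfl t ≠ 0 ↔ Odd (S.filter fun a => a ⊆ m ∪ t.1).card := by
    intro t
    rw [Cochain.delta_ne_zero_iff C rfl
      (S := ((X.link m hm).kFaces (k - m.card)).filter fun v => m ∪ v ∈ S) (filter_subset _ _)
      (fun v => by rw [hCv, mem_filter]; simp only [v.2, true_and])]
    have hcard : ((((X.link m hm).kFaces (k - m.card)).filter fun v => m ∪ v ∈ S).filter
        fun a => a ⊆ t.1).card = (S.filter fun a => a ⊆ m ∪ t.1).card := by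
      have h3 := X.sum_link hm (j := n - m.card) (l := n) (by omega)
        (fun a => if a ∈ S ∧ a ⊆ m ∪ t.1 then 1 else 0)
      have h4 : S.filter (fun a => a ⊆ m ∪ t.1) =
          ((X.level n).filter fun a => m ⊆ a).filter fun a => a ∈ S ∧ a ⊆ m ∪ t.1 := by
        ext a; simp only [mem_filter]
        exact ⟨fun h => ⟨⟨hSn h.1, hmS _ h.1⟩, h⟩, fun h => h.2⟩
      rw [h4, card_filter (fun a => a ∈ S ∧ a ⊆ m ∪ t.1), ← h3, filter_filter, card_filter,
        kFaces_eq_level _ (j := n - m.card) (by omega)]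
      refine sum_congr rfl fun v hv => ?_
      have : v ⊆ t.1 ↔ m ∪ v ⊆ m ∪ t.1 := by
        refine ⟨fun h => union_subset_union_right h, fun h x hx => ?_⟩
        exact (mem_union.1 (h (mem_union_right _ hx))).resolve_left
          fun hxm => disjoint_left.1 (mem_link.1 (mem_level.1 hv).1).1 hxm hx
      simp only [this]
    rw [hcard]
  have h2 := hX.wnorm_link hm (C.delta _ rfl) (l := n + 1) (by omega) (by push_cast; omega)
    (fun τ => Odd (S.filter fun a => a ⊆ τ).card) hodd
  have hs : ∑ τ ∈ (X.level n).filter (fun τ => m ⊆ τ), (if τ ∈ S then X.weight τ else 0) =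
      ∑ a ∈ S, X.weight a := by
    rw [← sum_filter]
    refine sum_congr ?_ fun _ _ => rfl
    ext τ; simp only [mem_filter]
    exact ⟨fun h => h.2, fun h => ⟨⟨hSn h, hmS _ h⟩, h⟩⟩
  rw [hs] at h1
  rw [← sum_filter] at h2
  have hw := X.weight_nonneg m
  have hc' : (n.choose m.card : ℝ) ≤ (n + 1).choose m.card := by
    exact_mod_cast Nat.choose_le_choose _ (Nat.le_succ n)
  calc β * ∑ a ∈ S, X.weight a = β * C.wnorm * (n.choose m.card * X.weight m) := by
        rw [← h1]; ring
    _ ≤ (C.delta _ rfl).wnorm * ((n + 1).choose m.card * X.weight m) := by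
        have := (C.delta _ rfl).wnorm_nonneg
        gcongr
    _ ≤ _ := by
        rw [h2]
        refine sum_le_sum_of_subset_of_nonneg ?_ fun _ _ _ => X.weight_nonneg _
        intro τ; simp only [mem_filter]
        exact fun h => ⟨h.1.1, h.2⟩

end IsDComplex
end FinComplex
-- Fat faces and their total weight.
namespace FinComplex

open Finset

variable {V : Type*} [DecidableEq V]

/-- The fat faces of codegree `c` below a set `A` of faces of cardinality `n`: the members of `A`
for `c = 0`, and then the faces whose link has a large proportion of vertices leading to fat faces
of the previous codegree. -/
noncomputable def fat (X : FinComplex V) (A : Finset (Finset V)) (η : ℝ) (n : ℕ) :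
    ℕ → Finset (Finset V)
  | 0 => A
  | c + 1 => X.faces.filter fun σ => σ.card + (c + 1) = n ∧
      η ^ 2 ^ c * ((σ.card + 1) * X.weight σ) ≤
        ∑ ρ ∈ (fat X A η n c).filter (fun ρ => σ ⊆ ρ), X.weight ρ

/-- `ρ` is a fat face and `ρ'` is a fat face of codimension one in `ρ`. -/
def Descends (X : FinComplex V) (A : Finset (Finset V)) (η : ℝ) (n : ℕ) (ρ ρ' : Finset V) : Prop :=
  ∃ c, ρ ∈ X.fat A η n c ∧ ρ' ∈ X.fat A η n (c + 1) ∧ ρ' ⊆ ρ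

/-- `τ` contains two adjacent fat faces whose intersection is not fat. -/
def Degenerate (X : FinComplex V) (A : Finset (Finset V)) (η : ℝ) (n : ℕ) (τ : Finset V) : Prop :=
  ∃ c, ∃ σ ∈ X.fat A η n c, ∃ σ' ∈ X.fat A η n c, σ ≠ σ' ∧ σ ⊆ τ ∧ σ' ⊆ τ ∧
    (σ ∩ σ').card + 1 = σ.card ∧ σ ∩ σ' ∉ X.fat A η n (c + 1)

theorem sum_biUnion_le_of_nonneg {ι κ : Type*} [DecidableEq κ] {f : κ → ℝ} (hf : ∀ x, 0 ≤ f x)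
    (s : Finset ι) (t : ι → Finset κ) : ∑ x ∈ s.biUnion t, f x ≤ ∑ i ∈ s, ∑ x ∈ t i, f x := by
  classical
  induction s using Finset.induction_on with
  | empty => simp
  | insert i s hi ih =>
    rw [biUnion_insert, sum_insert hi]
    have h1 := sum_union_inter (f := f) (s₁ := t i) (s₂ := s.biUnion t)
    have h2 : 0 ≤ ∑ x ∈ t i ∩ s.biUnion t, f x := sum_nonneg fun x _ => hf x
    linarith

theorem sum_superset_le {S T : Finset (Finset V)} {i j : ℕ} (hS : ∀ σ ∈ S, σ.card = i)
    (hT : ∀ ρ ∈ T, ρ.card = j) {f : Finset V → ℝ} (hf : ∀ ρ, 0 ≤ f ρ) :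
    ∑ σ ∈ S, ∑ ρ ∈ T.filter (fun ρ => σ ⊆ ρ), f ρ ≤ (j.choose i : ℝ) * ∑ ρ ∈ T, f ρ := by
  simp only [sum_filter]
  rw [sum_comm, mul_sum]
  refine sum_le_sum fun ρ hρ => ?_
  rw [← sum_filter, sum_const, nsmul_eq_mul]
  gcongr
  · exact hf ρ
  · rw [← hT ρ hρ, ← card_powersetCard]
    refine card_le_card fun σ hσ => ?_
    rw [mem_filter] at hσ
    exact mem_powersetCard.2 ⟨hσ.2, hS σ hσ.1⟩

variable {X : FinComplex V} {A : Finset (Finset V)} {η : ℝ} {n : ℕ}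

theorem fat_subset (hA : A ⊆ X.level n) {c : ℕ} {σ : Finset V} (h : σ ∈ X.fat A η n c) :
    σ ∈ X.faces ∧ σ.card + c = n := by
  cases c with
  | zero => simpa [mem_level] using hA h
  | succ c =>
    simp only [fat, mem_filter] at h
    exact ⟨h.1, h.2.1⟩

/-- Passing to the next codegree costs a factor `η ^ 2 ^ c`, by double counting of pairs of incident
fat faces. The doubling exponents are chosen so that the losses up to codegree `c` leave exactly one
factor `η` to spare over the current threshold; that spare factor makes degenerate faces rare. -/
theorem pow_mul_sum_fat_le (hA : A ⊆ X.level n) (hη : 0 < η) (c : ℕ) :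
    η ^ 2 ^ c * ∑ σ ∈ X.fat A η n c, X.weight σ ≤ η * ∑ σ ∈ A, X.weight σ := by
  induction c with
  | zero => simp [fat]
  | succ c ih =>
    refine le_trans ?_ ih
    rw [pow_succ, mul_two, pow_add, mul_assoc]
    gcongr
    rcases (X.fat A η n (c + 1)).eq_empty_or_nonempty with h | ⟨σ₀, hσ₀⟩
    · rw [h, sum_empty, mul_zero]
      exact sum_nonneg fun _ _ => X.weight_nonneg _
    · set i := σ₀.card
      have hi : i + (c + 1) = n := (fat_subset hA hσ₀).2
      have h1 : ∑ σ ∈ X.fat A η n (c + 1), η ^ 2 ^ c * ((i + 1) * X.weight σ) ≤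
          ∑ σ ∈ X.fat A η n (c + 1),
            ∑ ρ ∈ (X.fat A η n c).filter (fun ρ => σ ⊆ ρ), X.weight ρ := by
        refine sum_le_sum fun σ hσ => ?_
        have hc : σ.card = i := by have := (fat_subset hA hσ).2; omega
        simp only [fat, mem_filter] at hσ
        rw [← hc]
        exact hσ.2.2
      have h2 := h1.trans (sum_superset_le (i := i) (j := i + 1)
        (fun σ hσ => by have := (fat_subset hA hσ).2; omega)
        (fun σ hσ => by have := (fat_subset hA hσ).2; omega) X.weight_nonneg)
      rw [Nat.choose_succ_self_right, ← mul_sum, ← mul_sum] at h2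
      push_cast at h2
      have h3 : (0 : ℝ) < i + 1 := by positivity
      refine le_of_mul_le_mul_left (le_trans (le_of_eq ?_) h2) h3
      ring

/-- If `∅`, of weight `1`, were fat, the previous bound would give `η ^ 2 ^ n ≤ η ‖A‖ ≤ η * η ^ 2 ^
d`, impossible for `η < 1`. Hence descent ends at nonempty faces, where local minimality applies. -/
theorem empty_notMem_fat {d : ℕ} (hX : X.IsDComplex d) (hA : A ⊆ X.level n) (hn : n ≤ d)
    (hη : 0 < η) (hη1 : η < 1) (hsmall : ∑ σ ∈ A, X.weight σ ≤ η ^ 2 ^ d) :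
    ∅ ∉ X.fat A η n n := by
  intro h
  have h1 := pow_mul_sum_fat_le (c := n) hA hη
  have h2 : 1 ≤ ∑ σ ∈ X.fat A η n n, X.weight σ := by
    rw [← hX.weight_empty]
    exact single_le_sum (f := X.weight) (fun σ _ => X.weight_nonneg σ) h
  have h3 : η ^ 2 ^ d ≤ η ^ 2 ^ n :=
    pow_le_pow_of_le_one hη.le hη1.le (Nat.pow_le_pow_right (by norm_num) hn)
  have h4 : 0 < η ^ 2 ^ d := by positivity
  nlinarith [mul_le_mul_of_nonneg_left h2 (pow_pos hη (2 ^ n)).le]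

/-! ### Descent to terminal faces and its confluence. -/

theorem Descends.card (hA : A ⊆ X.level n) {ρ ρ' : Finset V} (h : X.Descends A η n ρ ρ') :
    ρ'.card + 1 = ρ.card := by
  obtain ⟨c, h1, h2, -⟩ := h
  have h1 := (fat_subset hA h1).2
  have h2 := (fat_subset hA h2).2
  omega

theorem exists_terminal (hA : A ⊆ X.level n) (ρ : Finset V) :
    ∃ m, Relation.ReflTransGen (X.Descends A η n) ρ m ∧ ∀ ρ', ¬ X.Descends A η n m ρ' := by
  induction h : ρ.card generalizing ρ with
  | zero =>
    exact ⟨ρ, .refl, fun ρ' h' => by have := h'.card hA; omega⟩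
  | succ i ih =>
    by_cases ht : ∀ ρ', ¬ X.Descends A η n ρ ρ'
    · exact ⟨ρ, .refl, ht⟩
    · push Not at ht
      obtain ⟨ρ', hρ'⟩ := ht
      obtain ⟨m, hm, ht⟩ := ih ρ' (by have := hρ'.card hA; omega)
      exact ⟨m, .head hρ' hm, ht⟩

theorem subset_of_reflTransGen {ρ m : Finset V}
    (h : Relation.ReflTransGen (X.Descends A η n) ρ m) : m ⊆ ρ := by
  induction h with
  | refl => exact subset_rfl
  | tail _ h ih =>
    obtain ⟨_, _, _, h⟩ := h
    exact h.trans ih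

theorem exists_fat_of_reflTransGen {a m : Finset V} (ha : a ∈ A)
    (h : Relation.ReflTransGen (X.Descends A η n) a m) : ∃ c, m ∈ X.fat A η n c := by
  induction h with
  | refl => exact ⟨0, ha⟩
  | tail _ h _ =>
    obtain ⟨c, _, h, _⟩ := h
    exact ⟨c + 1, h⟩

theorem inter_mem_fat (hA : A ⊆ X.level n) {τ : Finset V} (hτ : ¬ X.Degenerate A η n τ) {c : ℕ}
    {σ σ' : Finset V} (hσ : σ ∈ X.fat A η n c) (hσ' : σ' ∈ X.fat A η n c) (hne : σ ≠ σ')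
    (h : σ ⊆ τ) (h' : σ' ⊆ τ) {ρ : Finset V} (hρ : ρ.card = σ.card + 1) (hσρ : σ ⊆ ρ)
    (hσρ' : σ' ⊆ ρ) : σ ∩ σ' ∈ X.fat A η n (c + 1) := by
  by_contra hn
  refine hτ ⟨c, σ, hσ, σ', hσ', hne, h, h', ?_, hn⟩
  have h1 := card_union_add_card_inter σ σ'
  have h2 := card_le_card (union_subset hσρ hσρ')
  have h3 := (fat_subset hA hσ).2
  have h4 := (fat_subset hA hσ').2
  have h5 : (σ ∩ σ').card < σ.card := by
    refine card_lt_card ⟨inter_subset_left, fun h => hne ?_⟩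
    exact eq_of_subset_of_card_le (h.trans inter_subset_right) (by omega)
  omega

/-- Two fat faces of codimension one in the same face are adjacent, so their intersection is fat and
closes the diamond; Church–Rosser then gives confluence. -/
theorem join_of_not_degenerate (hA : A ⊆ X.level n) {τ : Finset V} (hτ : ¬ X.Degenerate A η n τ)
    {ρ b c : Finset V} (hρ : ρ ⊆ τ) (hb : Relation.ReflTransGen (X.Descends A η n) ρ b)
    (hc : Relation.ReflTransGen (X.Descends A η n) ρ c) :
    Relation.Join (Relation.ReflTransGen (X.Descends A η n)) b c := by
  -- The diamond property is known only below `τ`, so the relation is restricted to start there.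
  let r : Finset V → Finset V → Prop := fun x y => x ⊆ τ ∧ X.Descends A η n x y
  have lift : ∀ {y}, Relation.ReflTransGen (X.Descends A η n) ρ y → Relation.ReflTransGen r ρ y := by
    intro y h
    induction h with
    | refl => exact .refl
    | tail h1 h2 ih => exact ih.tail ⟨(subset_of_reflTransGen h1).trans hρ, h2⟩
  have hcr : ∀ x y z, r x y → r x z → ∃ w, Relation.ReflGen r y w ∧ Relation.ReflTransGen r z w := by
    rintro x y z ⟨hx, i, hxi, hy, hyx⟩ ⟨-, j, hxj, hz, hzx⟩
    have h1 := (fat_subset hA hxi).2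
    have h2 := (fat_subset hA hxj).2
    have h3 := (fat_subset hA hy).2
    obtain rfl : i = j := by omega
    by_cases hyz : y = z
    · subst hyz; exact ⟨y, .refl, .refl⟩
    · have h := inter_mem_fat hA hτ hy hz hyz (hyx.trans hx) (hzx.trans hx) (ρ := x) (by omega)
        hyx hzx
      exact ⟨y ∩ z, .single ⟨hyx.trans hx, _, hy, h, inter_subset_left⟩,
        .single ⟨hzx.trans hx, _, hz, h, inter_subset_right⟩⟩
  obtain ⟨w, h1, h2⟩ := Relation.church_rosser hcr (lift hb) (lift hc)
  have hr : r ≤ X.Descends A η n := fun _ _ h => h.2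
  exact ⟨w, Relation.ReflTransGen.mono hr _ _ h1, Relation.ReflTransGen.mono hr _ _ h2⟩

theorem eq_of_terminal {m ρ : Finset V} (hm : ∀ ρ', ¬ X.Descends A η n m ρ')
    (h : Relation.ReflTransGen (X.Descends A η n) m ρ) : m = ρ := by
  rcases h.cases_head with h | ⟨x, h, -⟩
  · exact h
  · exact absurd h (hm x)

/-- All descending paths from members of `A` inside a nondegenerate face of cardinality `n + 1`
end at the same face. -/
theorem reflTransGen_terminal (hA : A ⊆ X.level n) {τ : Finset V} (hτn : τ.card = n + 1)
    (hτ : ¬ X.Degenerate A η n τ) {a a' m : Finset V} (ha : a ∈ A) (ha' : a' ∈ A) (haτ : a ⊆ τ)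
    (haτ' : a' ⊆ τ) (hm : ∀ ρ', ¬ X.Descends A η n m ρ')
    (h : Relation.ReflTransGen (X.Descends A η n) a m) :
    Relation.ReflTransGen (X.Descends A η n) a' m := by
  by_cases hne : a = a'
  · exact hne ▸ h
  have hf : a ∩ a' ∈ X.fat A η n 1 := inter_mem_fat (c := 0) hA hτ ha ha' hne haτ haτ'
    (by rw [hτn, (mem_level.1 (hA ha)).2]) haτ haτ'
  have h1 : X.Descends A η n a (a ∩ a') := ⟨0, ha, hf, inter_subset_left⟩
  have h2 : X.Descends A η n a' (a ∩ a') := ⟨0, ha', hf, inter_subset_right⟩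
  obtain ⟨w, hw1, hw2⟩ := join_of_not_degenerate hA hτ haτ h (.single h1)
  rw [eq_of_terminal hm hw1]
  exact .head h2 hw2

/-! ### The weight of degenerate faces, by skeleton expansion. -/

open Classical in
/-- The degenerate faces have small total weight. -/
theorem sum_degenerate_le {d : ℕ} (hX : X.IsDComplex d) (hA : A ⊆ X.level n) (hn : n ≤ d)
    (hη : 0 < η) (hη1 : η ≤ 1)
    (hskel : ∀ (σ : Finset V) (hσ : σ ∈ X.faces), (σ.card : ℤ) ≤ d - 1 →
      (X.link σ hσ).IsSkeletonExpander (η ^ 2 ^ d)) :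
    ∑ τ ∈ (X.level (n + 1)).filter (X.Degenerate A η n), X.weight τ ≤
      d * (2 ^ (d + 1) * (4 * (d + 1) ^ 2)) * η * ∑ a ∈ A, X.weight a := by
  set E : ℕ → Finset V → Finset (Finset V) := fun c ρ =>
    ((X.level (ρ.card + 2)).filter fun e => ρ ⊆ e).filter fun e =>
      ∀ σ ∈ X.level (ρ.card + 1), ρ ⊆ σ → σ ⊆ e → σ ∈ X.fat A η n c with hE
  set G : ℕ → Finset (Finset V) := fun c => (X.level (n - (c + 1))).filter (· ∉ X.fat A η n (c + 1))
    with hG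
  set D : ℕ → Finset (Finset V) := fun c => (G c).biUnion fun ρ => (E c ρ).biUnion fun e =>
    (X.level (n + 1)).filter fun τ => e ⊆ τ with hD
  set W := ∑ a ∈ A, X.weight a with hW
  have hsub : (X.level (n + 1)).filter (X.Degenerate A η n) ⊆ (range n).biUnion D := by
    intro τ hτ
    rw [mem_filter, mem_level] at hτ
    obtain ⟨⟨hτX, hτn⟩, c, σ, hσ, σ', hσ', hne, hστ, hστ', hcard, hnf⟩ := hτ
    have h1 := (fat_subset hA hσ).2
    have h2 := (fat_subset hA hσ').2
    have h3 := card_union_add_card_inter σ σ'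
    simp only [hD, hG, hE, mem_biUnion, mem_range, mem_filter, mem_level]
    refine ⟨c, by omega, σ ∩ σ', ⟨⟨X.down_closed _ (fat_subset hA hσ).1 _ inter_subset_left,
      by omega⟩, hnf⟩, σ ∪ σ', ⟨⟨⟨X.down_closed _ hτX _ (union_subset hστ hστ'), by omega⟩,
      inter_subset_left.trans subset_union_left⟩, ?_⟩, ⟨hτX, hτn⟩, union_subset hστ hστ'⟩
    -- Only `σ` and `σ'` lie strictly between `σ ∩ σ'` and `σ ∪ σ'`: a third face would miss a point
    -- of each, and the union would be too large.
    rintro ρ ⟨-, hρc⟩ hρ1 hρ2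
    by_contra hρ
    obtain ⟨x, hx, hxρ⟩ : ∃ x ∈ σ, x ∉ ρ := by
      by_contra! hh
      exact hρ (eq_of_subset_of_card_le hh (by omega) ▸ hσ)
    obtain ⟨y, hy, hyρ⟩ : ∃ x ∈ σ', x ∉ ρ := by
      by_contra! hh
      exact hρ (eq_of_subset_of_card_le hh (by omega) ▸ hσ')
    have hxy : x ≠ y := by
      rintro rfl
      exact hxρ (hρ1 (mem_inter.2 ⟨hx, hy⟩))
    have h4 : ({x, y} : Finset V) ∪ ρ ⊆ σ ∪ σ' := by
      refine union_subset ?_ hρ2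
      simp [insert_subset_iff, hx, hy]
    have h5 := card_le_card h4
    rw [card_union_of_disjoint (by simp [hxρ, hyρ]), card_pair hxy] at h5
    omega
  have hDc : ∀ c ∈ range n, ∑ τ ∈ D c, X.weight τ ≤ 2 ^ (d + 1) * (4 * (d + 1) ^ 2) * η * W := by
    intro c hc
    rw [mem_range] at hc
    -- The skeleton parameter `η ^ 2 ^ d` is below the fatness threshold of every codegree, so it at
    -- most doubles the bound.
    have hη2 : η ^ 2 ^ d ≤ η ^ 2 ^ c :=
      pow_le_pow_of_le_one hη.le hη1 (Nat.pow_le_pow_right (by norm_num) (by omega))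
    have hfat := pow_mul_sum_fat_le (c := c) hA hη
    set F := X.fat A η n c with hF
    obtain ⟨i, hi⟩ : ∃ i, i + (c + 1) = n := ⟨n - (c + 1), by omega⟩
    have hGi : ∀ ρ ∈ G c, ρ ∈ X.faces ∧ ρ.card = i ∧ ρ ∉ X.fat A η n (c + 1) := by
      intro ρ hρ
      simp only [hG, mem_filter, mem_level] at hρ
      exact ⟨hρ.1.1, by omega, hρ.2⟩
    have hFl : F ⊆ X.level (i + 1) := fun σ hσ => by
      have := fat_subset hA hσ
      exact mem_level.2 ⟨this.1, by omega⟩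
    have hEρ : ∀ ρ ∈ G c, ∑ e ∈ E c ρ, X.weight e ≤
        4 * (d + 1) * η ^ 2 ^ c * ∑ σ ∈ F.filter (fun σ => ρ ⊆ σ), X.weight σ := by
      intro ρ hρ
      obtain ⟨hρX, hρc, hρf⟩ := hGi ρ hρ
      have h1 : ∑ σ ∈ F.filter (fun σ => ρ ⊆ σ), X.weight σ ≤
          η ^ 2 ^ c * ((ρ.card + 1) * X.weight ρ) := by
        simp only [fat, mem_filter, not_and, not_le] at hρf
        exact (hρf hρX (by omega)).le
      refine (hX.sum_edges_le hρX (hskel ρ hρX (by omega)) (by rw [hρc]; exact hFl) h1).trans ?_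
      have h2 : 0 ≤ ∑ σ ∈ F.filter (fun σ => ρ ⊆ σ), X.weight σ :=
        sum_nonneg fun _ _ => X.weight_nonneg _
      have h3 : (ρ.card : ℝ) + 2 ≤ d + 1 := by
        have : ρ.card + 2 ≤ d + 1 := by omega
        exact_mod_cast this
      have h4 : 0 < η ^ 2 ^ c := by positivity
      gcongr ?_ * _
      calc 2 * ((ρ.card : ℝ) + 2) * (η ^ 2 ^ c + η ^ 2 ^ d)
          ≤ 2 * (d + 1) * (η ^ 2 ^ c + η ^ 2 ^ c) := by gcongr
        _ = 4 * (d + 1) * η ^ 2 ^ c := by ring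
    have hτe : ∀ ρ ∈ G c, ∀ e ∈ E c ρ,
        ∑ τ ∈ (X.level (n + 1)).filter (fun τ => e ⊆ τ), X.weight τ ≤
          2 ^ (d + 1) * X.weight e := by
      intro ρ hρ e he
      simp only [hE, mem_filter, mem_level] at he
      have := (hGi ρ hρ).2.1
      rw [hX.sum_weight (by omega) (by omega)]
      have h1 : (n + 1).choose e.card ≤ 2 ^ (d + 1) :=
        (Nat.choose_le_two_pow _ _).trans (Nat.pow_le_pow_right (by norm_num) (by omega))
      have h2 := X.weight_nonneg e
      gcongr
      exact_mod_cast h1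
    calc ∑ τ ∈ D c, X.weight τ
        ≤ ∑ ρ ∈ G c, ∑ e ∈ E c ρ, ∑ τ ∈ (X.level (n + 1)).filter (fun τ => e ⊆ τ), X.weight τ := by
          refine (sum_biUnion_le_of_nonneg X.weight_nonneg _ _).trans (sum_le_sum fun ρ _ => ?_)
          exact sum_biUnion_le_of_nonneg X.weight_nonneg _ _
      _ ≤ ∑ ρ ∈ G c, 2 ^ (d + 1) * (4 * (d + 1) * η ^ 2 ^ c *
            ∑ σ ∈ F.filter (fun σ => ρ ⊆ σ), X.weight σ) := by
          refine sum_le_sum fun ρ hρ => (sum_le_sum (hτe ρ hρ)).trans ?_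
          rw [← mul_sum]
          gcongr
          exact hEρ ρ hρ
      _ = 2 ^ (d + 1) * (4 * (d + 1) * η ^ 2 ^ c) *
            ∑ ρ ∈ G c, ∑ σ ∈ F.filter (fun σ => ρ ⊆ σ), X.weight σ := by
          rw [mul_sum]; exact sum_congr rfl fun _ _ => by ring
      _ ≤ 2 ^ (d + 1) * (4 * (d + 1) * η ^ 2 ^ c) * ((d + 1) * ∑ σ ∈ F, X.weight σ) := by
          gcongr
          refine (sum_superset_le (i := i) (j := i + 1) (fun ρ hρ => (hGi ρ hρ).2.1)
            (fun σ hσ => (mem_level.1 (hFl hσ)).2) X.weight_nonneg).trans ?_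
          have h1 : 0 ≤ ∑ σ ∈ F, X.weight σ := sum_nonneg fun _ _ => X.weight_nonneg _
          rw [Nat.choose_succ_self_right]
          gcongr
          have : i + 1 ≤ d + 1 := by omega
          exact_mod_cast this
      _ = 2 ^ (d + 1) * (4 * (d + 1) ^ 2) * (η ^ 2 ^ c * ∑ σ ∈ F, X.weight σ) := by ring
      _ ≤ 2 ^ (d + 1) * (4 * (d + 1) ^ 2) * (η * W) := by gcongr
      _ = _ := by ring
  have hW0 : 0 ≤ W := sum_nonneg fun _ _ => X.weight_nonneg _
  calc _ ≤ ∑ τ ∈ (range n).biUnion D, X.weight τ :=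
        sum_le_sum_of_subset_of_nonneg hsub fun _ _ _ => X.weight_nonneg _
    _ ≤ ∑ c ∈ range n, ∑ τ ∈ D c, X.weight τ := sum_biUnion_le_of_nonneg X.weight_nonneg _ _
    _ ≤ n * (2 ^ (d + 1) * (4 * (d + 1) ^ 2) * η * W) := by
        refine (sum_le_sum hDc).trans_eq ?_
        simp
    _ ≤ d * (2 ^ (d + 1) * (4 * (d + 1) ^ 2) * η * W) := by
        gcongr
    _ = _ := by ring

end FinComplex
-- Comparing the coboundary of `A` with those of its pieces.
namespace FinComplex

open Finset

section

variable {V : Type*} [DecidableEq V] {X : FinComplex V}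

theorem IsCoboundaryExpander.mono {β β' : ℝ} (h : X.IsCoboundaryExpander β) (hβ : β' ≤ β) :
    X.IsCoboundaryExpander β' := fun k h0 hk =>
  (EReal.coe_le_coe_iff.2 hβ).trans (h k h0 hk)

variable {A : Finset (Finset V)} {η : ℝ} {n : ℕ}

open Classical in
/-- In a nondegenerate face, at most one terminal face `m` sees an odd number of members of `A`
descending to `m`, and if there is one then the total number of members of `A` is odd. -/
theorem card_odd_le_of_not_degenerate (hA : A ⊆ X.level n) {τ : Finset V} (hτn : τ.card = n + 1)
    (hτ : ¬ X.Degenerate A η n τ) {T : Finset (Finset V)}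
    (hT : ∀ m ∈ T, ∀ ρ', ¬ X.Descends A η n m ρ') :
    (T.filter fun m => Odd ((A.filter fun a =>
      Relation.ReflTransGen (X.Descends A η n) a m).filter fun a => a ⊆ τ).card).card ≤
      if Odd (A.filter fun a => a ⊆ τ).card then 1 else 0 := by
  set U := T.filter fun m => Odd ((A.filter fun a =>
    Relation.ReflTransGen (X.Descends A η n) a m).filter fun a => a ⊆ τ).card with hU
  have hex : ∀ m ∈ U, ∃ a ∈ A, Relation.ReflTransGen (X.Descends A η n) a m ∧ a ⊆ τ := by
    intro m hm
    obtain ⟨a, ha⟩ := card_pos.1 (mem_filter.1 hm).2.pos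
    simp only [mem_filter] at ha
    exact ⟨a, ha.1.1, ha.1.2, ha.2⟩
  rcases U.eq_empty_or_nonempty with h | ⟨m, hm⟩
  · simp [h]
  · obtain ⟨a, haA, ham, haτ⟩ := hex m hm
    have hmT := hT m (mem_filter.1 hm).1
    have hodd : Odd (A.filter fun a => a ⊆ τ).card := by
      convert (mem_filter.1 hm).2 using 2
      rw [filter_filter]
      refine filter_congr fun a' ha' => ⟨fun h => ⟨?_, h⟩, fun h => h.2⟩
      exact reflTransGen_terminal hA hτn hτ haA ha' haτ h hmT ham
    rw [if_pos hodd]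
    refine card_le_one.2 fun m₁ h₁ m₂ h₂ => ?_
    obtain ⟨a₁, ha₁, ham₁, haτ₁⟩ := hex m₁ h₁
    obtain ⟨a₂, ha₂, ham₂, haτ₂⟩ := hex m₂ h₂
    have hT₁ := hT m₁ (mem_filter.1 h₁).1
    have hT₂ := hT m₂ (mem_filter.1 h₂).1
    obtain ⟨w, hw₁, hw₂⟩ := join_of_not_degenerate hA hτ haτ₁ ham₁
      (reflTransGen_terminal hA hτn hτ ha₂ ha₁ haτ₂ haτ₁ hT₂ ham₂)
    rw [eq_of_terminal hT₁ hw₁, eq_of_terminal hT₂ hw₂]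

open Classical in
/-- The isoperimetric inequality up to the weight of the degenerate faces, provided that it holds
for all sets of members of `A` above a common nonempty face. -/
theorem mul_sum_le_add_degenerate {d : ℕ} (hA : A ⊆ X.level n) (hn : n ≤ d)
    (h0 : ∅ ∉ X.fat A η n n) {β : ℝ} (hβ : 0 ≤ β)
    (hloc : ∀ m ∈ X.faces, m ≠ ∅ → m.card ≤ n → ∀ S ⊆ A, (∀ a ∈ S, m ⊆ a) →
      β * ∑ a ∈ S, X.weight a ≤
        ∑ τ ∈ (X.level (n + 1)).filter (fun τ => Odd (S.filter fun a => a ⊆ τ).card),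
          X.weight τ) :
    β * ∑ a ∈ A, X.weight a ≤
      ∑ τ ∈ (X.level (n + 1)).filter (fun τ => Odd (A.filter fun a => a ⊆ τ).card), X.weight τ +
      2 ^ (d + 1) * ∑ τ ∈ (X.level (n + 1)).filter (X.Degenerate A η n), X.weight τ := by
  set T : Finset (Finset V) := X.faces.filter fun m =>
    m.card ≤ n ∧ m ≠ ∅ ∧ ∀ ρ', ¬ X.Descends A η n m ρ' with hT
  set S : Finset V → Finset (Finset V) := fun m =>
    A.filter fun a => Relation.ReflTransGen (X.Descends A η n) a m with hS
  -- The pieces may overlap, since a member of `A` can reach several terminal faces; the lower bound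
  -- only needs them to cover `A`.
  have hcover : A ⊆ T.biUnion S := by
    intro a ha
    obtain ⟨m, ham, hm⟩ := exists_terminal (η := η) hA a
    obtain ⟨c, hc⟩ := exists_fat_of_reflTransGen ha ham
    have hmf := fat_subset hA hc
    simp only [mem_biUnion, hT, hS, mem_filter]
    refine ⟨m, ⟨hmf.1, by omega, ?_, hm⟩, ha, ham⟩
    rintro rfl
    rw [card_empty, zero_add] at hmf
    exact h0 (hmf.2 ▸ hc)
  calc β * ∑ a ∈ A, X.weight a ≤ β * ∑ m ∈ T, ∑ a ∈ S m, X.weight a := by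
        gcongr
        exact (sum_le_sum_of_subset_of_nonneg hcover fun _ _ _ => X.weight_nonneg _).trans
          (sum_biUnion_le_of_nonneg X.weight_nonneg _ _)
    _ ≤ ∑ m ∈ T, ∑ τ ∈ (X.level (n + 1)).filter
          (fun τ => Odd ((S m).filter fun a => a ⊆ τ).card), X.weight τ := by
        rw [mul_sum]
        refine sum_le_sum fun m hm => ?_
        rw [hT, mem_filter] at hm
        exact hloc m hm.1 hm.2.2.1 hm.2.1 _ (filter_subset _ _)
          fun a ha => subset_of_reflTransGen (mem_filter.1 ha).2
    _ = ∑ τ ∈ X.level (n + 1),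
          ((T.filter fun m => Odd ((S m).filter fun a => a ⊆ τ).card).card : ℝ) * X.weight τ := by
        simp only [sum_filter (s := X.level (n + 1))]
        rw [sum_comm]
        refine sum_congr rfl fun τ _ => ?_
        rw [← sum_filter, sum_const, nsmul_eq_mul]
    _ ≤ ∑ τ ∈ X.level (n + 1), ((if Odd (A.filter fun a => a ⊆ τ).card then X.weight τ else 0) +
          2 ^ (d + 1) * if X.Degenerate A η n τ then X.weight τ else 0) := by
        refine sum_le_sum fun τ hτ => ?_
        have hw := X.weight_nonneg τ
        have hτn := (mem_level.1 hτ).2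
        by_cases hdeg : X.Degenerate A η n τ
        · rw [if_pos hdeg]
          -- In a degenerate face, any terminal face that contributes is a subset of `τ`; this crude
          -- count is the source of the factor `2 ^ (d + 1)`.
          have h1 : (T.filter fun m => Odd ((S m).filter fun a => a ⊆ τ).card).card ≤
              2 ^ (d + 1) := by
            calc _ ≤ τ.powerset.card := by
                  refine card_le_card fun m hm => ?_
                  obtain ⟨a, ha⟩ := card_pos.1 (mem_filter.1 hm).2.pos
                  simp only [hS, mem_filter] at ha
                  exact mem_powerset.2 ((subset_of_reflTransGen ha.1.2).trans ha.2)
              _ ≤ 2 ^ (d + 1) := by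
                  rw [card_powerset, hτn]
                  exact Nat.pow_le_pow_right (by norm_num) (by omega)
          have h2 : ((T.filter fun m => Odd ((S m).filter fun a => a ⊆ τ).card).card : ℝ) ≤
              2 ^ (d + 1) := by exact_mod_cast h1
          have h3 : 0 ≤ if Odd (A.filter fun a => a ⊆ τ).card then X.weight τ else 0 := by
            split_ifs <;> simp [hw]
          linarith [mul_le_mul_of_nonneg_right h2 hw]
        · rw [if_neg hdeg, mul_zero, add_zero]
          have h1 := card_odd_le_of_not_degenerate hA hτn hdeg (T := T)
            fun m hm => (mem_filter.1 hm).2.2.2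
          split_ifs with hodd
          · rw [if_pos hodd] at h1
            have h2 : ((T.filter fun m => Odd ((S m).filter fun a => a ⊆ τ).card).card : ℝ) ≤
                1 := by exact_mod_cast h1
            linarith [mul_le_mul_of_nonneg_right h2 hw]
          · rw [if_neg hodd] at h1
            rw [Nat.le_zero.1 h1]
            simp
    _ = _ := by
        rw [sum_add_distrib, ← mul_sum, ← sum_filter, ← sum_filter]

end

end FinComplex

/-! ### Choice of constants and conclusion. -/

open FinComplex Finset in
theorem mainTheorem3 (d : ℕ) (β : ℝ) (hβ : 0 < β) :
    ∃ ε μ α : ℝ, 0 < ε ∧ 0 < μ ∧ 0 < α ∧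
      ∀ (V : Type*) [DecidableEq V] (X : FinComplex V), X.IsDComplex d →
        (∀ (σ : Finset V) (hσ : σ ∈ X.faces), 1 ≤ (σ.card : ℤ) → (σ.card : ℤ) ≤ d - 1 →
          (X.link σ hσ).IsCoboundaryExpander β) →
        (∀ (σ : Finset V) (hσ : σ ∈ X.faces), (σ.card : ℤ) ≤ d - 1 →
          (X.link σ hσ).IsSkeletonExpander α) →
        ∀ k : ℤ, 0 ≤ k → k ≤ d - 1 → ∀ A : X.Cochain k,
          A.IsLocallyMinimal → A.wnorm ≤ μ →
            ε * A.wnorm ≤ (A.delta (k + 1) rfl).wnorm := by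
  classical
  -- Truncation at `1` serves the case of a terminal face that is itself a member of `A`.
  set b := min β 1 with hb
  have hb0 : 0 < b := lt_min hβ one_pos
  have hb1 : b ≤ 1 := min_le_right _ _
  -- `K * η` is the total relative error from degenerate faces, and `η` is chosen to make it at most
  -- half of `b`.
  set K : ℝ := 2 ^ (d + 1) * (d * (2 ^ (d + 1) * (4 * (d + 1) ^ 2))) with hK
  have hK0 : 0 ≤ K := by positivity
  set η := b / (2 * (K + 1)) with hη
  have hη0 : 0 < η := by positivity
  have hη1 : η < 1 := by
    rw [hη, div_lt_one (by positivity)]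
    linarith
  have hKη : K * η ≤ b / 2 := by
    have : (K + 1) * η = b / 2 := by rw [hη]; field_simp
    linarith
  refine ⟨b / 2, η ^ 2 ^ d, η ^ 2 ^ d, by positivity, by positivity, by positivity, ?_⟩
  intro V _ X hX hcob hskel k hk0 hkd A hmin hsmall
  obtain ⟨n, hn⟩ : ∃ n : ℕ, (n : ℤ) = k + 1 := ⟨(k + 1).toNat, by omega⟩
  have hnd : n ≤ d := by omega
  set S : Finset (Finset V) := (X.kFaces k).filter fun a => ∃ h, A ⟨a, h⟩ ≠ 0 with hS
  have hmemS : ∀ σ, A σ ≠ 0 ↔ σ.1 ∈ S := by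
    intro σ
    rw [hS, mem_filter]
    exact ⟨fun h => ⟨σ.2, σ.2, h⟩, fun ⟨_, _, h⟩ => h⟩
  have hSl : S ⊆ X.level n := by
    rw [← X.kFaces_eq_level hn]; exact filter_subset _ _
  have hnorm : A.wnorm = ∑ a ∈ S, X.weight a := by
    rw [A.wnorm_eq_sum hn (· ∈ S) hmemS, ← sum_filter]
    congr 1
    ext a
    simp only [mem_filter]
    exact ⟨fun h => h.2, fun h => ⟨hSl h, h⟩⟩
  have hdelta : (A.delta (k + 1) rfl).wnorm =
      ∑ τ ∈ (X.level (n + 1)).filter (fun τ => Odd (S.filter fun a => a ⊆ τ).card),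
        X.weight τ := by
    rw [Cochain.wnorm_eq_sum _ (j := n + 1) (by push_cast; rw [hn])
      (fun τ => Odd (S.filter fun a => a ⊆ τ).card)
      (A.delta_ne_zero_iff rfl (filter_subset _ _) hmemS), ← sum_filter]
  rw [hnorm] at hsmall
  have hdeg := sum_degenerate_le hX hSl hnd hη0 hη1.le hskel
  have hmain := mul_sum_le_add_degenerate hSl hnd
    (empty_notMem_fat hX hSl hnd hη0 hη1 hsmall) hb0.le (by
      intro m hm hne hmn S' hS' hmS'
      have hpos := Finset.card_pos.2 (Finset.nonempty_iff_ne_empty.2 hne)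
      refine hX.sum_odd_ge hb1 hnd hn hm hmn
        (fun hlt => (hcob m hm (by omega) (by omega)).mono (min_le_left _ _))
        (hmin m hm hne) (fun a ha => ?_) hmS'
      exact (mem_filter.1 (hS' ha)).2)
  rw [hnorm, hdelta]
  have hW : 0 ≤ ∑ a ∈ S, X.weight a := sum_nonneg fun _ _ => X.weight_nonneg _
  have h1 : (2 : ℝ) ^ (d + 1) * ∑ τ ∈ (X.level (n + 1)).filter (X.Degenerate S η n), X.weight τ ≤
      K * η * ∑ a ∈ S, X.weight a := by
    refine (mul_le_mul_of_nonneg_left hdeg (by positivity)).trans_eq ?_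
    rw [hK]; ring
  have h2 := mul_le_mul_of_nonneg_right hKη hW
  linarith
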